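/- Rings are unital, not necessarily commutative. For a ring $A$ and $S\subset A$ let $i_S:A\to A_S=\langle A,\{x_s\}_{s\in S}\mid x_ss=sx_s=1\rangle$ be the universal homomorphism inverting $S$; write $A_a=A_{\{a\}}$. A homomorphism $\phi:A\to B$ to a nonzero ring $B$ determines a sequence $\mathcal S=(S_1,S_2,\dots)$ by $A_0=A$, $\phi_0=\phi$, $S_{n+1}=\phi_n^{-1}(\mathrm U(B))$, $A_{n+1}=(A_n)_{S_{n+1}}$, and $\phi_{n+1}:A_{n+1}\to B$ the homomorphism induced by $\phi_n$, where $\mathrm U(B)$ is the group of units of $B$. The sequences arising in this way are the fully invertible systems on $A$; put $A_{\mathcal S}=\varinjlim_n A_n$, with canonical map $i_{\mathcal S}:A\to A_{\mathcal S}$, and let $F(A)$ be the set of all of them. A fraction of $A$ is a tuple $\mathbf a=(a_1,\dots,a_n)$ with $a_1\in A$, $a_2\in A_{a_1}$, $a_3\in (A_{a_1})_{a_2}$, etc.; put $A_{\mathbf a}=(\cdots(A_{a_1})_{a_2}\cdots)_{a_n}$. Write $\mathbf a\in\mathcal S$ if successively $a_i\in S_i$ for $1\le i\le n$ (where $a_i$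 is regarded as an element of $A_{i-1}$ via the canonical homomorphism $(\cdots(A_{a_1})\cdots)_{a_{i-1}}\to A_{i-1}$); then there is a canonical homomorphism $A_{\mathbf a}\to A_{\mathcal S}$. Give $F(A)$ the topology generated by the fundamental sets $D(\mathbf a)=\{\mathcal S\in F(A)\mid \mathbf a\in\mathcal S\}$. Let $\mathcal O_A$ be the sheaf of rings on $F(A)$ for which $\mathcal O_A(U)$ is the ring of all functions $t$ on $U$ with $t(\mathcal S)\in A_{\mathcal S}$ such that every point of $U$ has an open neighbourhood $U_0\subset U$ on which $t$ is given by one polynomial presentation. That is, there are finitely many $a_r\in A$, finitely many indices $(i,j)$ with $i\ge 1$, noncommutative integer polynomials $g_{ij}$ in the $a_r$ and symbols $x_{pq}$ with $p<i$, and a noncommutative integer polynomial $f$ in the $a_r$ and all the $x_{ij}$, such that for each $\mathcal S\in U_0$ there are $s_{ij}\in S_i$ with $s_{ij}=g_{ij}(a,(x_{s_{pq}})_{p<i})$ in $A_{i-1}$ and $t(\mathcal S)=f(a,(x_{s_{ij}}))$ in $A_{\mathcal S}$. **Proposition.** Let $A$ be a nonzero ring. 1. For every $\mathcal S\in F(A)$,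 evaluation $t\mapsto t(\mathcal S)$ induces a ring isomorphism $\mathcal O_{A,\mathcal S}\cong A_{\mathcal S}$ from the stalk. 2. For every fraction $\mathbf a$ of $A$ with $D(\mathbf a)\ne\emptyset$ there is a ring isomorphism $\mathcal O_A(D(\mathbf a))\cong A_{\mathbf a}$, under which $b\in A_{\mathbf a}$ corresponds to the section whose value at each $\mathcal S\in D(\mathbf a)$ is the image of $b$ in $A_{\mathcal S}$. In particular $\Gamma(F(A),\mathcal O_A)\cong A$, with $a\in A$ corresponding to the section $\mathcal S\mapsto i_{\mathcal S}(a)$. -/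

import Mathlib

open CategoryTheory TopologicalSpace Opposite

universe u

noncomputable section

namespace FSpec

/-! ### Universal localization of a (noncommutative) ring at a subset -/

/-- The defining relations of `A_S = ⟨A, {x_s}_{s ∈ S} | x_s s = s x_s = 1⟩`, on the free ring on
the symbols `a ∈ A` (`Sum.inl a`) and `x_s`, `s ∈ S` (`Sum.inr s`). The first three say that
`a ↦ [a]` is a ring homomorphism. -/
inductive LocRel (A : Type u) [Ring A] (S : Set A) :
    FreeAlgebra ℤ (A ⊕ S) → FreeAlgebra ℤ (A ⊕ S) → Prop
  | add (a b : A) : LocRel A S (FreeAlgebra.ι ℤ (Sum.inl (a + b)))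
      (FreeAlgebra.ι ℤ (Sum.inl a) + FreeAlgebra.ι ℤ (Sum.inl b))
  | mul (a b : A) : LocRel A S (FreeAlgebra.ι ℤ (Sum.inl (a * b)))
      (FreeAlgebra.ι ℤ (Sum.inl a) * FreeAlgebra.ι ℤ (Sum.inl b))
  | one : LocRel A S (FreeAlgebra.ι ℤ (Sum.inl 1)) 1
  | left (s : S) : LocRel A S
      (FreeAlgebra.ι ℤ (Sum.inr s) * FreeAlgebra.ι ℤ (Sum.inl (s : A))) 1
  | right (s : S) : LocRel A S
      (FreeAlgebra.ι ℤ (Sum.inl (s : A)) * FreeAlgebra.ι ℤ (Sum.inr s)) 1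

/-- The localization `A_S`. -/
def Loc (A : Type u) [Ring A] (S : Set A) : Type u := RingQuot (LocRel A S)

instance (A : Type u) [Ring A] (S : Set A) : Ring (Loc A S) :=
  inferInstanceAs (Ring (RingQuot (LocRel A S)))

namespace Loc

variable {A : Type u} [Ring A] (S : Set A)

/-- The quotient map from the free ring. -/
def mk : FreeAlgebra ℤ (A ⊕ S) →+* Loc A S := RingQuot.mkRingHom (LocRel A S)

/-- The canonical homomorphism `i_S : A → A_S`. -/
def of : A →+* Loc A S :=
  RingHom.mk' ⟨⟨fun a => mk S (FreeAlgebra.ι ℤ (Sum.inl a)),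
      (RingQuot.mkRingHom_rel LocRel.one).trans (map_one (mk S))⟩,
      fun a b => (RingQuot.mkRingHom_rel (LocRel.mul a b)).trans (map_mul (mk S) _ _)⟩
    fun a b => (RingQuot.mkRingHom_rel (LocRel.add a b)).trans (map_add (mk S) _ _)

/-- The element `x_s` of `A_S`. -/
def x (s : S) : Loc A S := mk S (FreeAlgebra.ι ℤ (Sum.inr s))

theorem x_mul_of (s : S) : x S s * of S (s : A) = 1 :=
  ((map_mul (mk S) _ _).symm.trans (RingQuot.mkRingHom_rel (LocRel.left s))).trans
    (map_one (mk S))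

theorem of_mul_x (s : S) : of S (s : A) * x S s = 1 :=
  ((map_mul (mk S) _ _).symm.trans (RingQuot.mkRingHom_rel (LocRel.right s))).trans
    (map_one (mk S))

theorem isUnit_of {a : A} (h : a ∈ S) : IsUnit (of S a) :=
  ⟨⟨of S a, x S ⟨a, h⟩, of_mul_x S ⟨a, h⟩, x_mul_of S ⟨a, h⟩⟩, rfl⟩

variable {S} {B : Type*} [Ring B]

/-- The homomorphism `φ_S : A_S → B` induced by `φ : A → B` with `φ(S) ⊆ U(B)`. -/
def lift (φ : A →+* B) (h : ∀ s ∈ S, IsUnit (φ s)) : Loc A S →+* B :=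
  RingQuot.lift ⟨(FreeAlgebra.lift ℤ (Sum.elim φ
      fun s : S => ((h s s.2).unit⁻¹ : Bˣ)) : FreeAlgebra ℤ (A ⊕ S) →ₐ[ℤ] B).toRingHom, by
    intro p q hpq
    cases hpq with
    | add a b => simp
    | mul a b => simp
    | one => simp
    | left s => simp
    | right s => simp⟩

theorem lift_mk (φ : A →+* B) (h : ∀ s ∈ S, IsUnit (φ s)) (p : FreeAlgebra ℤ (A ⊕ S)) :
    lift φ h (mk S p) = FreeAlgebra.lift ℤ (Sum.elim φ
      fun s : S => ((h s s.2).unit⁻¹ : Bˣ)) p :=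
  RingQuot.lift_mkRingHom_apply _ _ _

theorem lift_of (φ : A →+* B) (h : ∀ s ∈ S, IsUnit (φ s)) (a : A) :
    lift φ h (of S a) = φ a := by
  refine (lift_mk φ h _).trans ?_
  simp

end Loc

/-! ### Sequences `(S_1, S_2, …)` of subsets of successive localizations -/

/-- The type of tuples `(S_1, …, S_n)` with `S_{i+1}` a subset of `A_i`, where `A_0 = A` and
`A_{i+1} = (A_i)_{S_{i+1}}`, together with the ring `A_n` belonging to such a tuple. -/
def setTower (A : Type u) [Ring A] : ℕ → (P : Type u) × (P → RingCat.{u})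
  | 0 => ⟨PUnit, fun _ => RingCat.of A⟩
  | n + 1 => ⟨(p : (setTower A n).1) × Set ((setTower A n).2 p),
      fun q => RingCat.of (Loc ((setTower A n).2 q.1) q.2)⟩

/-- Tuples `(S_1, …, S_n)` with `S_{i+1} ⊆ A_i`. -/
def Tuple (A : Type u) [Ring A] (n : ℕ) : Type u := (setTower A n).1

namespace Tuple

variable {A : Type u} [Ring A]

/-- The ring `A_n` of a tuple `(S_1, …, S_n)`. -/
def ring {n : ℕ} (p : Tuple A n) : Type u := (setTower A n).2 p

instance {n : ℕ} (p : Tuple A n) : Ring p.ring := inferInstanceAs (Ring ((setTower A n).2 p))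

/-- The empty tuple; its ring is `A`. -/
def nil : Tuple A 0 := PUnit.unit

/-- `(S_1, …, S_n), S ↦ (S_1, …, S_n, S)`; the ring of the latter is `(A_n)_S`. -/
def snoc {n : ℕ} (p : Tuple A n) (S : Set p.ring) : Tuple A (n + 1) := ⟨p, S⟩

theorem nil_ring : (nil : Tuple A 0).ring = A := rfl

theorem snoc_ring {n : ℕ} (p : Tuple A n) (S : Set p.ring) : (p.snoc S).ring = Loc p.ring S := rfl

/-- Equal tuples have the same ring. -/
def castHom {n : ℕ} {p q : Tuple A n} (h : p = q) : p.ring →+* q.ring :=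
  h ▸ RingHom.id p.ring

end Tuple

/-- A sequence `(S_1, S_2, …)` with `S_{n+1} = set n` a subset of `A_n = (tuple n).ring`, where
`A_0 = A`, `A_{n+1} = (A_n)_{S_{n+1}}`, and `tuple n = (S_1, …, S_n)`. -/
@[ext]
structure SetSeq (A : Type u) [Ring A] where
  tuple : ∀ n, Tuple A n
  set : ∀ n, Set (tuple n).ring
  tuple_succ : ∀ n, tuple (n + 1) = (tuple n).snoc (set n)

namespace SetSeq

variable {A : Type u} [Ring A]

/-- The tuple `(S_1, …, S_n)` coming from `φ : A → B`, with the homomorphism `φ_n : A_n → B`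
extending `φ`: here `φ_0 = φ` and `S_{n+1} = φ_n⁻¹(U(B))`. -/
def homTower {B : Type u} [Ring B] (φ : A →+* B) : (n : ℕ) → (p : Tuple A n) × (p.ring →+* B)
  | 0 => ⟨Tuple.nil, φ⟩
  | n + 1 => ⟨(homTower φ n).1.snoc {a | IsUnit ((homTower φ n).2 a)},
      Loc.lift (homTower φ n).2 fun _ h => h⟩

/-- The sequence `(S_1, S_2, …)` coming from `φ : A → B`. -/
def ofHom {B : Type u} [Ring B] (φ : A →+* B) : SetSeq A where
  tuple n := (homTower φ n).1
  set n := {a | IsUnit ((homTower φ n).2 a)}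
  tuple_succ _ := rfl

/-- A fully invertible system on `A`: a sequence coming from a homomorphism from `A` to some
nonzero ring. -/
def IsFullyInvertible (s : SetSeq A) : Prop :=
  ∃ (B : Type u) (_ : Ring B) (_ : Nontrivial B) (φ : A →+* B), s = ofHom φ

variable (s : SetSeq A)

/-- The ring `A_n`. -/
abbrev ring (n : ℕ) : Type u := (s.tuple n).ring

/-- The identity `A → A_0`. -/
def base : A →+* s.ring 0 := RingHom.id A

/-- The identification of `(A_n)_{S_{n+1}}` with `A_{n+1}`. -/
def locHom (n : ℕ) : Loc (s.ring n) (s.set n) →+* s.ring (n + 1) :=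
  Tuple.castHom (s.tuple_succ n).symm

/-- The canonical homomorphism `A_n → A_{n+1}`. -/
def step (n : ℕ) : s.ring n →+* s.ring (n + 1) := (s.locHom n).comp (Loc.of (s.set n))

/-- The element `x_t` of `A_{n+1}`, for `t ∈ S_{n+1}`. -/
def x (n : ℕ) (t : s.ring n) (ht : t ∈ s.set n) : s.ring (n + 1) :=
  s.locHom n (Loc.x (s.set n) ⟨t, ht⟩)

theorem isUnit_step {n : ℕ} {t : s.ring n} (ht : t ∈ s.set n) : IsUnit (s.step n t) :=
  (Loc.isUnit_of (s.set n) ht).map (s.locHom n)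

/-- The canonical homomorphism `A_m → A_n`, `m ≤ n`. -/
def map (m n : ℕ) (h : m ≤ n) : s.ring m →+* s.ring n :=
  Nat.leRec (motive := fun k _ => s.ring m →+* s.ring k) (RingHom.id _)
    (fun k _ f => (s.step k).comp f) h

theorem map_self (m : ℕ) : s.map m m le_rfl = RingHom.id _ := Nat.leRec_self _ _

theorem map_succ (m n : ℕ) (h : m ≤ n) :
    s.map m (n + 1) (h.trans n.le_succ) = (s.step n).comp (s.map m n h) :=
  Nat.leRec_succ _ _ h

instance : DirectedSystem s.ring (fun _ _ h => s.map _ _ h) where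
  map_self m a := by rw [map_self]; rfl
  map_map k j i hij hjk a := by
    induction k, hjk using Nat.le_induction with
    | base => rw [map_self]; rfl
    | succ k hjk ih =>
      rw [map_succ s j k hjk, map_succ s i k (hij.trans hjk), RingHom.comp_apply, ih]; rfl

/-- The localization `A_𝒮`, the direct limit of the rings `A_n`. -/
def Localization : Type u := DirectLimit s.ring s.map

instance : Ring s.Localization := inferInstanceAs (Ring (DirectLimit s.ring s.map))

/-- The canonical homomorphism `A_n → A_𝒮`. -/
def toLim (n : ℕ) : s.ring n →+* s.Localization := DirectLimit.Ring.of s.ring s.map n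

/-- The canonical homomorphism `i_𝒮 : A → A_𝒮`. -/
def i : A →+* s.Localization := (s.toLim 0).comp s.base

end SetSeq

/-! ### The full spectrum -/

/-- The full spectrum `F(A)`: the set of all fully invertible systems on `A`. -/
@[ext]
structure FullSpectrum (A : Type u) [Ring A] where
  sys : SetSeq A
  isFullyInvertible : sys.IsFullyInvertible

/-- Fractions `(a_1, …, a_n)` of `A`, i.e. `a_1 ∈ A`, `a_2 ∈ A_{a_1}`, `a_3 ∈ (A_{a_1})_{a_2}`, …,
together with the ring `A_𝐚 = (…(A_{a_1})…)_{a_n}` belonging to such a fraction. -/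
def fracTower (A : Type u) [Ring A] : ℕ → (P : Type u) × (P → RingCat.{u})
  | 0 => ⟨PUnit, fun _ => RingCat.of A⟩
  | n + 1 => ⟨(p : (fracTower A n).1) × (fracTower A n).2 p,
      fun q => RingCat.of (Loc ((fracTower A n).2 q.1) {q.2})⟩

/-- Fractions `𝐚 = (a_1, …, a_n)` of `A`. -/
def Fraction (A : Type u) [Ring A] (n : ℕ) : Type u := (fracTower A n).1

namespace Fraction

variable {A : Type u} [Ring A]

/-- The ring `A_𝐚`. -/
def ring {n : ℕ} (a : Fraction A n) : Type u := (fracTower A n).2 a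

instance {n : ℕ} (a : Fraction A n) : Ring a.ring := inferInstanceAs (Ring ((fracTower A n).2 a))

/-- `(a_1, …, a_{n+1}) ↦ (a_1, …, a_n)`. -/
def init {n : ℕ} (a : Fraction A (n + 1)) : Fraction A n := Sigma.fst a

/-- `(a_1, …, a_{n+1}) ↦ a_{n+1}`. -/
def last {n : ℕ} (a : Fraction A (n + 1)) : a.init.ring := Sigma.snd a

theorem ring_zero (a : Fraction A 0) : a.ring = A := rfl

theorem ring_succ {n : ℕ} (a : Fraction A (n + 1)) : a.ring = Loc a.init.ring {a.last} := rfl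

/-- The statement `𝐚 ∈ 𝒮`, i.e. `a_i ∈ S_i` for `1 ≤ i ≤ n`, together with the canonical
homomorphism `A_{(a_1, …, a_n)} → A_n = (…(A_{S_1})…)_{S_n}` which exists when it holds and which is
used to regard `a_{n+1}` as an element of `A_n`. -/
def memTower (s : SetSeq A) : (n : ℕ) → (a : Fraction A n) → (P : Prop) ×' (P → a.ring →+* s.ring n)
  | 0, _ => ⟨True, fun _ => s.base⟩
  | n + 1, a => ⟨∃ h : (memTower s n a.init).1, (memTower s n a.init).2 h a.last ∈ s.set n,
      fun h => Loc.lift ((s.step n).comp ((memTower s n a.init).2 h.1)) (by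
        rintro _ rfl
        exact s.isUnit_step h.2)⟩

/-- `𝐚 ∈ 𝒮`. -/
def Mem {n : ℕ} (a : Fraction A n) (s : SetSeq A) : Prop := (memTower s n a).1

/-- The canonical homomorphism `A_𝐚 → A_𝒮` for `𝐚 ∈ 𝒮`. -/
def toLocalization {n : ℕ} (a : Fraction A n) (s : SetSeq A) (h : a.Mem s) :
    a.ring →+* s.Localization :=
  (s.toLim n).comp ((memTower s n a).2 h)

/-- The fundamental set `D(𝐚) = {𝒮 ∈ F(A) | 𝐚 ∈ 𝒮}`. -/
def D {n : ℕ} (a : Fraction A n) : Set (FullSpectrum A) := {S | a.Mem S.sys}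

end Fraction

instance (A : Type u) [Ring A] : TopologicalSpace (FullSpectrum A) :=
  TopologicalSpace.generateFrom {U | ∃ (n : ℕ) (a : Fraction A n), U = a.D}

/-- `D(𝐚)` as an open subset of `F(A)`. -/
def Fraction.opens {A : Type u} [Ring A] {n : ℕ} (a : Fraction A n) : Opens (FullSpectrum A) :=
  ⟨a.D, TopologicalSpace.isOpen_generateFrom_of_mem ⟨n, a, rfl⟩⟩

/-! ### The structure sheaf -/

/-- The data of a polynomial presentation. The finite type `ι` is the set of index pairs `(i, j)` of
the elements `s_{ij} ∈ S_i`, with `level (i, j) = i - 1`, so that `s_{ij} ∈ A_{level (i, j)}`. Each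
`s_{ij}` is given by a noncommutative polynomial over `ℤ` in the `a_r` and in the `x_{s_{pq}}` with
`p < i` (that is, `s_{ij}` depends on the `s_{pq}`, `p < i`), and `poly` is the polynomial `f` in
the `a_r` and all the `x_{s_{ij}}`. -/
structure Presentation (A : Type u) where
  κ : Type
  finite_κ : Finite κ
  coeff : κ → A
  ι : Type
  finite_ι : Finite ι
  level : ι → ℕ
  denom : ∀ j : ι, FreeAlgebra ℤ (κ ⊕ {k : ι // level k < level j})
  poly : FreeAlgebra ℤ (κ ⊕ ι)

namespace Presentation

variable {A : Type u} [Ring A] (P : Presentation A) (s : SetSeq A)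

/-- A family of elements `d j ∈ S_{level j + 1}` is *the* family of denominators of `P` at `s` if
`d j` is the value in `A_{level j}` of the polynomial `P.denom j`. -/
def IsDenom (d : ∀ j, s.ring (P.level j)) (hd : ∀ j, d j ∈ s.set (P.level j)) : Prop :=
  ∀ j, d j = FreeAlgebra.lift ℤ
    (Sum.elim (fun r => s.map 0 (P.level j) (Nat.zero_le _) (s.base (P.coeff r)))
      (fun k : {k // P.level k < P.level j} =>
        s.map (P.level k + 1) (P.level j) k.2 (s.x (P.level k) (d k) (hd k)))) (P.denom j)

/-- The presentation `P` makes sense at the system `s` and `y ∈ A_s` is its value. -/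
def Presents (y : s.Localization) : Prop :=
  ∃ (d : ∀ j, s.ring (P.level j)) (hd : ∀ j, d j ∈ s.set (P.level j)), P.IsDenom s d hd ∧
    y = FreeAlgebra.lift ℤ
      (Sum.elim (fun r => s.i (P.coeff r))
        (fun j => s.toLim (P.level j + 1) (s.x (P.level j) (d j) (hd j)))) P.poly

/-- Renaming the variables of a noncommutative polynomial. -/
def rename {σ τ : Type} (g : σ → τ) : FreeAlgebra ℤ σ →ₐ[ℤ] FreeAlgebra ℤ τ :=
  FreeAlgebra.lift ℤ (fun v => FreeAlgebra.ι ℤ (g v))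

theorem lift_rename {σ τ : Type} {R : Type*} [Ring R] (g : σ → τ) (v : τ → R)
    (p : FreeAlgebra ℤ σ) :
    FreeAlgebra.lift ℤ v (rename g p) = FreeAlgebra.lift ℤ (fun w => v (g w)) p := by
  have : (FreeAlgebra.lift ℤ v).comp (rename g) = FreeAlgebra.lift ℤ (fun w => v (g w)) := by
    ext w
    simp [rename]
  exact DFunLike.congr_fun this p

theorem eq_lift_inl {κ ι : Type} {R : Type*} [Ring R] (f : κ → R) (g : ι → R) (k : κ) :
    f k = FreeAlgebra.lift ℤ (Sum.elim f g) (FreeAlgebra.ι ℤ (Sum.inl k)) := by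
  simp

/-- The presentation of a constant `a ∈ A`. -/
def const (a : A) : Presentation A where
  κ := Unit
  finite_κ := inferInstance
  coeff _ := a
  ι := Empty
  finite_ι := inferInstance
  level := Empty.elim
  denom j := j.elim
  poly := FreeAlgebra.ι ℤ (Sum.inl ())

theorem presents_const (a : A) : (const a).Presents s (s.i a) :=
  ⟨fun j => j.elim, fun j => j.elim, fun j => j.elim,
    eq_lift_inl (κ := Unit) (ι := Empty) (fun _ => s.i a) _ ()⟩

/-- The union of the data of two presentations, with a new polynomial `f`. -/
def union (P Q : Presentation A) (f : FreeAlgebra ℤ ((P.κ ⊕ Q.κ) ⊕ (P.ι ⊕ Q.ι))) :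
    Presentation A where
  κ := P.κ ⊕ Q.κ
  finite_κ := by
    have := P.finite_κ
    have := Q.finite_κ
    infer_instance
  coeff := Sum.elim P.coeff Q.coeff
  ι := P.ι ⊕ Q.ι
  finite_ι := by
    have := P.finite_ι
    have := Q.finite_ι
    infer_instance
  level := Sum.elim P.level Q.level
  denom j := match j with
    | Sum.inl j => rename (Sum.map Sum.inl fun k => ⟨Sum.inl k.1, k.2⟩) (P.denom j)
    | Sum.inr j => rename (Sum.map Sum.inr fun k => ⟨Sum.inr k.1, k.2⟩) (Q.denom j)
  poly := f

theorem presents_union {P Q : Presentation A} {s : SetSeq A} {y z w : s.Localization}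
    (hP : P.Presents s y) (hQ : Q.Presents s z)
    (f : FreeAlgebra ℤ ((P.κ ⊕ Q.κ) ⊕ (P.ι ⊕ Q.ι)))
    (hw : ∀ v : (P.κ ⊕ Q.κ) ⊕ (P.ι ⊕ Q.ι) → s.Localization,
      y = FreeAlgebra.lift ℤ v (rename (Sum.map Sum.inl Sum.inl) P.poly) →
      z = FreeAlgebra.lift ℤ v (rename (Sum.map Sum.inr Sum.inr) Q.poly) →
      w = FreeAlgebra.lift ℤ v f) :
    (union P Q f).Presents s w := by
  obtain ⟨d, hd, h, hy⟩ := hP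
  obtain ⟨e, he, h', hz⟩ := hQ
  refine ⟨fun j => match j with
    | Sum.inl j => d j
    | Sum.inr j => e j, fun j => match j with
    | Sum.inl j => hd j
    | Sum.inr j => he j, ?_, ?_⟩
  · rintro (j | j)
    · refine (h j).trans (Eq.trans ?_ (lift_rename _ _ _).symm)
      congr 2
      funext v
      rcases v with v | v <;> rfl
    · refine (h' j).trans (Eq.trans ?_ (lift_rename _ _ _).symm)
      congr 2
      funext v
      rcases v with v | v <;> rfl
  · apply hw
    · refine hy.trans (Eq.trans ?_ (lift_rename _ _ _).symm)
      congr 2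
      funext v
      rcases v with v | v <;> rfl
    · refine hz.trans (Eq.trans ?_ (lift_rename _ _ _).symm)
      congr 2
      funext v
      rcases v with v | v <;> rfl

theorem presents_neg {P : Presentation A} {s : SetSeq A} {y : s.Localization}
    (hP : P.Presents s y) : ({ P with poly := -P.poly } : Presentation A).Presents s (-y) := by
  obtain ⟨d, hd, h, rfl⟩ := hP
  exact ⟨d, hd, h, (map_neg (FreeAlgebra.lift ℤ _) _).symm⟩

end Presentation

variable (A : Type u) [Ring A]

/-- The functions `t : U → ∐ A_𝒮` given on all of `U` by one polynomial presentation. -/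
def presentedPrelocal : TopCat.PrelocalPredicate
    (X := TopCat.of (FullSpectrum A)) (fun S => S.sys.Localization) where
  pred {U} t := ∃ P : Presentation A, ∀ S : U, P.Presents S.1.sys (t S)
  res := by
    rintro U V i f ⟨P, hP⟩
    exact ⟨P, fun S => hP ⟨S.1, i.le S.2⟩⟩

/-- The functions `t : U → ∐ A_𝒮` which are locally given by a polynomial presentation. -/
def presentedLocal : TopCat.LocalPredicate
    (X := TopCat.of (FullSpectrum A)) (fun S => S.sys.Localization) :=
  (presentedPrelocal A).sheafify

/-- The ring `𝒪_A(U)`, with pointwise operations. -/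
def sections (U : Opens (TopCat.of (FullSpectrum A))) :
    Subring (∀ S : U, S.1.sys.Localization) where
  carrier := {t | (presentedLocal A).pred t}
  zero_mem' S := ⟨U, S.2, 𝟙 U, Presentation.const 0, fun T => by
    simpa using Presentation.presents_const T.1.sys (0 : A)⟩
  one_mem' S := ⟨U, S.2, 𝟙 U, Presentation.const 1, fun T => by
    simpa using Presentation.presents_const T.1.sys (1 : A)⟩
  add_mem' {a b} ha hb S := by
    obtain ⟨V, hV, i, P, hP⟩ := ha S
    obtain ⟨W, hW, j, Q, hQ⟩ := hb S
    exact ⟨V ⊓ W, ⟨hV, hW⟩, Opens.infLELeft _ _ ≫ i,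
      P.union Q (Presentation.rename (Sum.map Sum.inl Sum.inl) P.poly +
        Presentation.rename (Sum.map Sum.inr Sum.inr) Q.poly),
      fun T => Presentation.presents_union (hP ⟨T.1, T.2.1⟩) (hQ ⟨T.1, T.2.2⟩) _
        fun v hy hz => (congrArg₂ (· + ·) hy hz).trans (map_add _ _ _).symm⟩
  mul_mem' {a b} ha hb S := by
    obtain ⟨V, hV, i, P, hP⟩ := ha S
    obtain ⟨W, hW, j, Q, hQ⟩ := hb S
    exact ⟨V ⊓ W, ⟨hV, hW⟩, Opens.infLELeft _ _ ≫ i,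
      P.union Q (Presentation.rename (Sum.map Sum.inl Sum.inl) P.poly *
        Presentation.rename (Sum.map Sum.inr Sum.inr) Q.poly),
      fun T => Presentation.presents_union (hP ⟨T.1, T.2.1⟩) (hQ ⟨T.1, T.2.2⟩) _
        fun v hy hz => (congrArg₂ (· * ·) hy hz).trans (map_mul _ _ _).symm⟩
  neg_mem' {a} ha S := by
    obtain ⟨V, hV, i, P, hP⟩ := ha S
    exact ⟨V, hV, i, { P with poly := -P.poly }, fun T => Presentation.presents_neg (hP T)⟩

/-- The presheaf of rings `U ↦ 𝒪_A(U)`, with restriction of functions. -/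
def structurePresheaf : TopCat.Presheaf RingCat.{u} (TopCat.of (FullSpectrum A)) where
  obj U := RingCat.of (sections A U.unop)
  map {U V} i := RingCat.ofHom
    { toFun := fun t => ⟨fun S => t.1 ⟨S.1, i.unop.le S.2⟩, (presentedLocal A).res i.unop t.1 t.2⟩
      map_one' := rfl
      map_mul' := fun _ _ => rfl
      map_zero' := rfl
      map_add' := fun _ _ => rfl }

/-- The underlying presheaf of sets is the presheaf of locally presented functions. -/
def structurePresheafCompForget : structurePresheaf A ⋙ forget RingCat ≅
    TopCat.subpresheafToTypes (presentedLocal A).toPrelocalPredicate :=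
  NatIso.ofComponents fun _ => Iso.refl _

/-- The structure sheaf `𝒪_A` on `F(A)`. -/
def structureSheaf : TopCat.Sheaf RingCat.{u} (TopCat.of (FullSpectrum A)) :=
  ⟨structurePresheaf A,
    (TopCat.Presheaf.isSheaf_iff_isSheaf_comp (forget RingCat) _).mpr
      (TopCat.Presheaf.isSheaf_of_iso (structurePresheafCompForget A).symm
        (TopCat.subpresheafToTypes.isSheaf (presentedLocal A)))⟩

variable {A}

/-- The value `t(𝒮) ∈ A_𝒮` of a section `t ∈ 𝒪_A(U)` at `𝒮 ∈ U`. -/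
def value {U : Opens (TopCat.of (FullSpectrum A))}
    (t : (structureSheaf A).presheaf.obj (op U)) (S : FullSpectrum A) (h : S ∈ U) :
    S.sys.Localization :=
  (show sections A U from t).1 ⟨S, h⟩

end FSpec

end

/-!
Everything is controlled by homomorphisms of rings under `A`. The maps `A → A_𝐚` and `A → A_𝒮` are
epimorphisms (`Fraction.hom_ext`, `SetSeq.hom_ext`), so such homomorphisms are unique when they
exist. For a system `𝒮` determined by `φ : A → B`, the induced homomorphism `A_𝒮 → B` reflects
units, and `S_{n+1}` consists of the elements of `A_n` which become invertible in `A_𝒮`. Hence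
`𝐚 ∈ 𝒮` if and only if there is a homomorphism `A_𝐚 → A_𝒮` under `A`
(`Fraction.mem_iff_exists_hom`), and a polynomial presentation makes sense at `𝒮` with value `y` if
and only if it can be evaluated to `y` in `A_𝒮`, all of its denominators being units there
(`Presentation.presents_iff_hasValue`). Such values are unique and are preserved by homomorphisms
under `A`.

Sections over `D(𝐚)`: the homomorphism `A → A_𝐚` determines a point of `D(𝐚)`, its *center*. If `𝐛`
belongs to the center, there are homomorphisms `A_𝐛 → A_center → A_𝐚 → A_𝒮` for all `𝒮 ∈ D(𝐚)`, so
that `D(𝐚) ⊆ D(𝐛)`: every neighbourhood of the center contains `D(𝐚)`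
(`Fraction.D_subset_of_center_mem`). A section over `D(𝐚)` is therefore given by a single
presentation, and its value at the center, carried to `A_𝐚`, induces all of its values. Conversely
every element of `A_𝐚` has a presentation (`Fraction.exists_hasValue`), because the elements which
have one form a subring closed under inverses.

Stalks: since any two fractions in `𝒮` have a common refinement in `𝒮`, the sets `D(𝐚)` form a
basis, and every germ at `𝒮` comes from some `A_𝐚` with `𝐚 ∈ 𝒮`. So `A → 𝒪_{A,𝒮}` is an
epimorphism. Evaluation `𝒪_{A,𝒮} → A_𝒮` reflects units: if `b ∈ A_𝐚` becomes a unit in `A_𝒮`, then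
`(𝐚, b) ∈ 𝒮`. By the universal property of `A_𝒮` there is a homomorphism `A_𝒮 → 𝒪_{A,𝒮}` under `A`,
and it is inverse to evaluation because `A` maps epimorphically to both rings
(`stalkValue_bijective`).
-/

noncomputable section

namespace FSpec

/-! ### Homomorphisms out of universal localizations -/

theorem map_freeAlgebra_lift {R R' : Type*} [Ring R] [Ring R'] (f : R →+* R') {X : Type*}
    (v : X → R) (p : FreeAlgebra ℤ X) :
    f (FreeAlgebra.lift ℤ v p) = FreeAlgebra.lift ℤ (fun k => f (v k)) p := by
  have : f.toIntAlgHom.comp (FreeAlgebra.lift ℤ v) = FreeAlgebra.lift ℤ (fun k => f (v k)) := by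
    ext k
    simp
  exact DFunLike.congr_fun this p

namespace Loc

variable {A : Type u} [Ring A] {S : Set A} {R : Type*} [Ring R]

theorem mem_of_subring (T : Subring (Loc A S)) (h : ∀ a, of S a ∈ T) (h' : ∀ s, x S s ∈ T)
    (y : Loc A S) : y ∈ T := by
  obtain ⟨p, rfl⟩ : ∃ p, mk S p = y := RingQuot.mkRingHom_surjective _ y
  induction p using FreeAlgebra.induction with
  | grade0 n =>
    have : mk S (algebraMap ℤ _ n) = (n : Loc A S) := by
      rw [← map_intCast (mk S) n]
      exact congrArg _ (eq_intCast (algebraMap ℤ (FreeAlgebra ℤ (A ⊕ S))) n)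
    rw [this]
    exact intCast_mem T n
  | grade1 k =>
    rcases k with a | s
    · exact h a
    · exact h' s
  | mul p q hp hq => rw [map_mul]; exact mul_mem hp hq
  | add p q hp hq => rw [map_add]; exact add_mem hp hq

/-- `A → A_S` is an epimorphism: the image of `x_s` is determined as the inverse of the image of
`s`. -/
theorem hom_ext {f g : Loc A S →+* R} (h : f.comp (of S) = g.comp (of S)) : f = g := by
  have h0 : ∀ a, f (of S a) = g (of S a) := fun a => DFunLike.congr_fun h a
  refine RingHom.ext fun y => mem_of_subring (f.eqLocus g) h0 (fun s => ?_) y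
  refine left_inv_eq_right_inv (a := f (of S s)) ?_ ?_
  · rw [← map_mul, x_mul_of, map_one]
  · rw [h0, ← map_mul, of_mul_x, map_one]

theorem lift_comp_of (φ : A →+* R) (h : ∀ s ∈ S, IsUnit (φ s)) : (lift φ h).comp (of S) = φ :=
  RingHom.ext (lift_of φ h)

end Loc

theorem Tuple.castHom_surjective {A : Type u} [Ring A] {n : ℕ} {p q : Tuple A n} (h : p = q) :
    Function.Surjective (Tuple.castHom h) := by
  subst h
  exact Function.surjective_id

namespace SetSeq

variable {A : Type u} [Ring A] (s : SetSeq A) {R : Type*} [Ring R]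

theorem toLim_succ_comp_step (n : ℕ) : (s.toLim (n + 1)).comp (s.step n) = s.toLim n := by
  ext t
  have h := DirectLimit.Ring.of_f (G := s.ring) (f := s.map) (i := n) (j := n + 1) n.le_succ t
  rw [map_succ s n n le_rfl, map_self] at h
  exact h

theorem toLim_map {m n : ℕ} (h : m ≤ n) (t : s.ring m) :
    s.toLim n (s.map m n h t) = s.toLim m t :=
  DirectLimit.Ring.of_f (G := s.ring) (f := s.map) h t

theorem toLim_step (n : ℕ) (t : s.ring n) : s.toLim (n + 1) (s.step n t) = s.toLim n t :=
  DFunLike.congr_fun (s.toLim_succ_comp_step n) t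

theorem isUnit_toLim {n : ℕ} {t : s.ring n} (ht : t ∈ s.set n) : IsUnit (s.toLim n t) := by
  rw [← toLim_step]
  exact (s.isUnit_step ht).map _

theorem exists_toLim (y : s.Localization) : ∃ n t, s.toLim n t = y := by
  induction y using DirectLimit.induction with
  | _ n t => exact ⟨n, t, rfl⟩

theorem step_mul_x (n : ℕ) (t : s.ring n) (ht : t ∈ s.set n) : s.step n t * s.x n t ht = 1 := by
  have := Loc.of_mul_x (s.set n) ⟨t, ht⟩
  exact (map_mul (s.locHom n) _ _).symm.trans ((congrArg _ this).trans (map_one _))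

/-- `A → A_𝒮` is an epimorphism. -/
theorem hom_ext {f g : s.Localization →+* R} (h : f.comp s.i = g.comp s.i) : f = g := by
  have key : ∀ n, f.comp (s.toLim n) = g.comp (s.toLim n) := by
    intro n
    induction n with
    | zero =>
      -- `s.ring 0` is by definition `A`, and `s.i` is `s.toLim 0`
      exact h
    | succ n ih =>
      have h1 : (f.comp (s.toLim (n + 1))).comp (s.locHom n) =
          (g.comp (s.toLim (n + 1))).comp (s.locHom n) := by
        apply Loc.hom_ext
        rw [← toLim_succ_comp_step] at ih
        exact ih
      exact (RingHom.cancel_right (Tuple.castHom_surjective _)).mp h1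
  ext y
  obtain ⟨n, t, rfl⟩ := s.exists_toLim y
  exact DFunLike.congr_fun (key n) t

/-- The homomorphism `A_{n+1} → R` induced by `A_n → R` and inverting `S_{n+1}`. -/
theorem exists_lift_succ (n : ℕ) (f : s.ring n →+* R) (h : ∀ t ∈ s.set n, IsUnit (f t)) :
    ∃ g : s.ring (n + 1) →+* R, g.comp (s.step n) = f := by
  have aux : ∀ (q : Tuple A (n + 1)) (e : (s.tuple n).snoc (s.set n) = q),
      ∃ g : q.ring →+* R, (g.comp (Tuple.castHom e)).comp (Loc.of (s.set n)) = f := by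
    rintro _ rfl
    exact ⟨Loc.lift f h, Loc.lift_comp_of f h⟩
  exact aux _ (s.tuple_succ n).symm

theorem exists_hom_of_compatible (f : ∀ n, s.ring n →+* R) (h : ∀ n, (f (n + 1)).comp (s.step n) = f n) :
    ∃ g : s.Localization →+* R, ∀ n, g.comp (s.toLim n) = f n := by
  have hc : ∀ i j (hij : i ≤ j) (t : s.ring i), f j (s.map i j hij t) = f i t := by
    intro i j hij t
    induction j, hij using Nat.le_induction with
    | base => rw [map_self]; rfl
    | succ j hij ih => rw [map_succ s i j hij, ← ih, ← h j]; rfl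
  exact ⟨DirectLimit.Ring.lift s.ring s.map R f hc, fun n => RingHom.ext fun t =>
    rfl⟩

/-- A ring `C` under `A` with a unit-reflecting
homomorphism to `A_𝒮` receives a homomorphism from `A_𝒮` under `A`. Level by level, the elements of
`S_{n+1}` become units in `A_𝒮`, hence in `C`. -/
theorem exists_hom_of_isLocalHom {C : Type*} [Ring C] (j : A →+* C) (e : C →+* s.Localization)
    (hj : e.comp j = s.i) (he : ∀ c, IsUnit (e c) → IsUnit c) :
    ∃ g : s.Localization →+* C, g.comp s.i = j := by
  have hunit : ∀ n (f : s.ring n →+* C), e.comp f = s.toLim n →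
      ∀ t ∈ s.set n, IsUnit (f t) := by
    intro n f hf t ht
    apply he
    have := s.isUnit_toLim ht
    rwa [← hf] at this
  have hex : ∀ n (f : s.ring n →+* C), e.comp f = s.toLim n →
      ∃ g : s.ring (n + 1) →+* C, g.comp (s.step n) = f ∧ e.comp g = s.toLim (n + 1) := by
    intro n f hf
    obtain ⟨g, hg⟩ := s.exists_lift_succ n f (hunit n f hf)
    refine ⟨g, hg, ?_⟩
    have h1 : (e.comp g).comp (s.locHom n) = (s.toLim (n + 1)).comp (s.locHom n) := by
      apply Loc.hom_ext
      change e.comp (g.comp (s.step n)) = (s.toLim (n + 1)).comp (s.step n)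
      rw [hg, hf, toLim_succ_comp_step]
    exact (RingHom.cancel_right (Tuple.castHom_surjective _)).mp h1
  choose G hG hG' using hex
  let F : ∀ n, {f : s.ring n →+* C // e.comp f = s.toLim n} := fun n =>
    Nat.rec ⟨j, hj⟩ (fun n f => ⟨G n f.1 f.2, hG' n f.1 f.2⟩) n
  obtain ⟨g, hg⟩ := s.exists_hom_of_compatible (fun n => (F n).1) fun n => hG n (F n).1 (F n).2
  exact ⟨g, hg 0⟩

/-! ### Fully invertible systems -/

theorem exists_hom_ofHom {B : Type u} [Ring B] (φ : A →+* B) :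
    ∃ ψ : (ofHom φ).Localization →+* B, ∀ n, ψ.comp ((ofHom φ).toLim n) = (homTower φ n).2 :=
  (ofHom φ).exists_hom_of_compatible (fun n => (homTower φ n).2) fun _ =>
    Loc.lift_comp_of _ fun _ h => h

/-- The homomorphism `A_𝒮 → B` induced by the homomorphism `A → B` which determines `𝒮`. -/
def toTarget {B : Type u} [Ring B] (φ : A →+* B) : (ofHom φ).Localization →+* B :=
  (exists_hom_ofHom φ).choose

variable {B : Type u} [Ring B] (φ : A →+* B)

theorem toTarget_toLim (n : ℕ) (t : (ofHom φ).ring n) :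
    toTarget φ ((ofHom φ).toLim n t) = (homTower φ n).2 t :=
  DFunLike.congr_fun ((exists_hom_ofHom φ).choose_spec n) t

theorem toTarget_comp_i : (toTarget φ).comp (ofHom φ).i = φ :=
  RingHom.ext fun a => toTarget_toLim φ 0 a

theorem mem_set_ofHom {n : ℕ} {t : (ofHom φ).ring n} :
    t ∈ (ofHom φ).set n ↔ IsUnit (toTarget φ ((ofHom φ).toLim n t)) := by
  rw [toTarget_toLim]
  rfl

/-- `A_𝒮 → B` reflects units. -/
theorem isUnit_of_isUnit_toTarget {y : (ofHom φ).Localization} (h : IsUnit (toTarget φ y)) :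
    IsUnit y := by
  obtain ⟨n, t, rfl⟩ := exists_toLim _ y
  exact isUnit_toLim _ ((mem_set_ofHom φ).mpr h)

variable {s}

/-- In a fully invertible system, `S_{n+1}` consists of the elements of `A_n` which become
invertible in `A_𝒮`. -/
theorem IsFullyInvertible.mem_set_iff (hs : s.IsFullyInvertible) {n : ℕ} {t : s.ring n} :
    t ∈ s.set n ↔ IsUnit (s.toLim n t) := by
  refine ⟨s.isUnit_toLim, fun h => ?_⟩
  obtain ⟨B, _, _, φ, rfl⟩ := hs
  exact (mem_set_ofHom φ).mpr (h.map _)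

theorem IsFullyInvertible.nontrivial (hs : s.IsFullyInvertible) : Nontrivial s.Localization := by
  obtain ⟨B, _, _, φ, rfl⟩ := hs
  exact (toTarget φ).domain_nontrivial

end SetSeq

/-! ### Fractions -/

namespace Fraction

variable {A : Type u} [Ring A] {R : Type*} [Ring R]

/-- The canonical homomorphism `A → A_𝐚`. -/
def of : {n : ℕ} → (a : Fraction A n) → A →+* a.ring
  | 0, _ => RingHom.id A
  | _ + 1, a => (Loc.of {a.last}).comp (of a.init)

/-- `(a_1, …, a_n), c ↦ (a_1, …, a_n, c)`. -/
def snoc {n : ℕ} (a : Fraction A n) (c : a.ring) : Fraction A (n + 1) := ⟨a, c⟩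

/-- The canonical homomorphism `A_{(a_1, …, a_n)} → A_{(a_1, …, a_n, c)}`. -/
def ofSnoc {n : ℕ} (a : Fraction A n) (c : a.ring) : a.ring →+* (a.snoc c).ring := Loc.of {c}

theorem ofSnoc_comp_of {n : ℕ} (a : Fraction A n) (c : a.ring) :
    (a.ofSnoc c).comp a.of = (a.snoc c).of := rfl

theorem isUnit_ofSnoc {n : ℕ} (a : Fraction A n) (c : a.ring) : IsUnit (a.ofSnoc c c) :=
  Loc.isUnit_of _ rfl

/-- `A → A_𝐚` is an epimorphism. -/
theorem hom_ext {n : ℕ} (a : Fraction A n) {f g : a.ring →+* R} (h : f.comp a.of = g.comp a.of) :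
    f = g := by
  induction n with
  | zero => exact h
  | succ n ih =>
    have h' : f.comp (Loc.of {a.last}) = g.comp (Loc.of {a.last}) := ih a.init h
    exact Loc.hom_ext h'

/-- A homomorphism over `A` out of `A_𝐚` extends to `A_{(𝐚, c)}` if it sends `c` to a unit. -/
theorem exists_hom_snoc {n : ℕ} (a : Fraction A n) (c : a.ring) (f : a.ring →+* R)
    (h : IsUnit (f c)) : ∃ g : (a.snoc c).ring →+* R, g.comp (a.snoc c).of = f.comp a.of := by
  have hc : ∀ t ∈ ({c} : Set a.ring), IsUnit (f t) := fun _ ht => (congrArg f ht).symm ▸ h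
  exact ⟨Loc.lift f hc, RingHom.ext fun r => Loc.lift_of f hc (a.of r)⟩

/-- Homomorphisms over `A` out of `A_𝐚` lift along unit-reflecting homomorphisms. -/
theorem exists_hom_lift {C : Type*} [Ring C] (j : A →+* C) (e : C →+* R)
    (he : ∀ c, IsUnit (e c) → IsUnit c) {n : ℕ} (a : Fraction A n) (f : a.ring →+* R)
    (hf : f.comp a.of = e.comp j) : ∃ g : a.ring →+* C, g.comp a.of = j := by
  induction n with
  | zero => exact ⟨j, rfl⟩
  | succ n ih =>
    obtain ⟨g, hg⟩ := ih a.init (f.comp (a.init.ofSnoc a.last)) hf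
    have : e.comp g = f.comp (a.init.ofSnoc a.last) := a.init.hom_ext (by
      rw [RingHom.comp_assoc, hg, ← hf]; rfl)
    obtain ⟨k, hk⟩ := a.init.exists_hom_snoc a.last g (he _ (by
      have hu := (a.init.isUnit_ofSnoc a.last).map f
      exact (DFunLike.congr_fun this a.last).symm ▸ hu))
    exact ⟨k, hk.trans hg⟩

theorem toLocalization_comp_of {s : SetSeq A} {n : ℕ} (a : Fraction A n) (h : a.Mem s) :
    (a.toLocalization s h).comp a.of = s.i := by
  induction n with
  | zero => rfl
  | succ n ih =>
    obtain ⟨h1, h2⟩ := h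
    rw [← ih a.init h1]
    refine RingHom.ext fun b => ?_
    refine (congrArg (s.toLim (n + 1)) (Loc.lift_of ((s.step n).comp ((memTower s n a.init).2 h1))
      (by rintro _ rfl; exact s.isUnit_step h2) _)).trans ?_
    exact s.toLim_step n _

theorem eq_toLocalization {s : SetSeq A} {n : ℕ} (a : Fraction A n) (h : a.Mem s)
    (f : a.ring →+* s.Localization) (hf : f.comp a.of = s.i) : f = a.toLocalization s h :=
  a.hom_ext (hf.trans (a.toLocalization_comp_of h).symm)

/-- `𝐚 ∈ 𝒮` if and only if there is a homomorphism `A_𝐚 → A_𝒮` over `A`. -/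
theorem mem_iff_exists_hom {s : SetSeq A} (hs : s.IsFullyInvertible) {n : ℕ} (a : Fraction A n) :
    a.Mem s ↔ ∃ f : a.ring →+* s.Localization, f.comp a.of = s.i := by
  refine ⟨fun h => ⟨_, a.toLocalization_comp_of h⟩, ?_⟩
  rintro ⟨f, hf⟩
  induction n with
  | zero => trivial
  | succ n ih =>
    have h := ih a.init (f.comp (a.init.ofSnoc a.last)) hf
    refine ⟨h, hs.mem_set_iff.mpr ?_⟩
    have hu := (a.init.isUnit_ofSnoc a.last).map f
    exact DFunLike.congr_fun (a.init.eq_toLocalization h (f.comp (a.init.ofSnoc a.last)) hf)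
      a.last ▸ hu

/-- For the system `𝒮` determined by `φ : A → B`, `𝐚 ∈ 𝒮` as soon as `φ` extends to `A_𝐚`. -/
theorem mem_ofHom {B : Type u} [Ring B] [Nontrivial B] (φ : A →+* B) {n : ℕ} (a : Fraction A n)
    (f : a.ring →+* B) (hf : f.comp a.of = φ) : a.Mem (SetSeq.ofHom φ) :=
  (a.mem_iff_exists_hom ⟨B, _, ‹_›, φ, rfl⟩).mpr <|
    a.exists_hom_lift _ (SetSeq.toTarget φ) (fun _ => SetSeq.isUnit_of_isUnit_toTarget φ) f
      (hf.trans (SetSeq.toTarget_comp_i φ).symm)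

/-- A fraction in `𝒮` may be extended by any element which becomes a unit in `A_𝒮`. -/
theorem mem_snoc {s : SetSeq A} (hs : s.IsFullyInvertible) {n : ℕ} (a : Fraction A n)
    (h : a.Mem s) (c : a.ring) (hc : IsUnit (a.toLocalization s h c)) : (a.snoc c).Mem s := by
  obtain ⟨g, hg⟩ := a.exists_hom_snoc c _ hc
  exact (mem_iff_exists_hom hs _).mpr ⟨g, hg.trans (a.toLocalization_comp_of h)⟩

theorem mem_of_hom {s : SetSeq A} (hs : s.IsFullyInvertible) {m n : ℕ} {a : Fraction A m}
    {b : Fraction A n} (f : a.ring →+* b.ring) (hf : f.comp a.of = b.of) (hb : b.Mem s) :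
    a.Mem s :=
  (mem_iff_exists_hom hs _).mpr ⟨(b.toLocalization s hb).comp f, by
    rw [RingHom.comp_assoc, hf, toLocalization_comp_of]⟩

/-- Two fractions in `𝒮` have a common refinement in `𝒮`, obtained by concatenation. -/
theorem exists_common_refinement {s : SetSeq A} (hs : s.IsFullyInvertible) {m n : ℕ}
    (a : Fraction A m) (b : Fraction A n) (ha : a.Mem s) (hb : b.Mem s) :
    ∃ (k : ℕ) (c : Fraction A k), c.Mem s ∧ (∃ f : a.ring →+* c.ring, f.comp a.of = c.of) ∧
      ∃ g : b.ring →+* c.ring, g.comp b.of = c.of := by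
  induction n with
  | zero => exact ⟨m, a, ha, ⟨RingHom.id _, rfl⟩, a.of, rfl⟩
  | succ n ih =>
    obtain ⟨k, c, hc, ⟨f, hf⟩, g, hg⟩ := ih b.init hb.1
    have hbi : b.init.Mem s := hb.1
    have hu : IsUnit (c.toLocalization s hc (g b.last)) := by
      rw [← RingHom.comp_apply, b.init.eq_toLocalization hbi ((c.toLocalization s hc).comp g)
        (by rw [RingHom.comp_assoc, hg, toLocalization_comp_of])]
      exact s.isUnit_toLim hb.2
    obtain ⟨l, hl⟩ := b.init.exists_hom_snoc b.last ((c.ofSnoc (g b.last)).comp g)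
      (c.isUnit_ofSnoc _)
    refine ⟨k + 1, c.snoc (g b.last), mem_snoc hs c hc _ hu,
      ⟨(c.ofSnoc _).comp f, ?_⟩, l, hl.trans ?_⟩
    · rw [RingHom.comp_assoc, hf, ofSnoc_comp_of]
    · rw [RingHom.comp_assoc, hg, ofSnoc_comp_of]

end Fraction

/-! ### Values of polynomial presentations in rings under `A` -/

namespace SetSeq

variable {A : Type u} [Ring A] (s : SetSeq A)

theorem toLim_x {n : ℕ} {t : s.ring n} (ht : t ∈ s.set n) (v : s.Localizationˣ)
    (hv : s.toLim n t = v) : s.toLim (n + 1) (s.x n t ht) = (v⁻¹ : s.Localizationˣ) := by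
  refine (Units.inv_eq_of_mul_eq_one_right ?_).symm
  rw [← hv, ← toLim_step, ← map_mul, step_mul_x, map_one]

end SetSeq

namespace Presentation

variable {A : Type u} [Ring A] {R R' : Type*} [Ring R] [Ring R'] {P Q : Presentation A}
  {φ : A →+* R} {y z : R}

/-- The presentation `P` has value `y` in the ring `R` under `A`: its denominators, evaluated in
`R` level by level, are units `v j`, and `y` is the value of its polynomial. In contrast to
`Presentation.Presents`, no sequence of localizations is involved, so that values are preserved by
every homomorphism of rings under `A`. -/
def HasValue (P : Presentation A) (φ : A →+* R) (y : R) : Prop :=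
  ∃ v : P.ι → Rˣ, (∀ j, (v j : R) = FreeAlgebra.lift ℤ (Sum.elim (fun r => φ (P.coeff r))
      fun k : {k // P.level k < P.level j} => ((v k)⁻¹ : Rˣ)) (P.denom j)) ∧
    y = FreeAlgebra.lift ℤ (Sum.elim (fun r => φ (P.coeff r)) fun j => ((v j)⁻¹ : Rˣ)) P.poly

theorem HasValue.map (h : P.HasValue φ y) (f : R →+* R') : P.HasValue (f.comp φ) (f y) := by
  obtain ⟨v, hv, rfl⟩ := h
  refine ⟨fun j => Units.map f (v j), fun j => ?_, ?_⟩
  · refine (congrArg f (hv j)).trans ((map_freeAlgebra_lift f _ _).trans ?_)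
    congr 2
    funext k
    rcases k with k | k <;> rfl
  · refine (map_freeAlgebra_lift f _ _).trans ?_
    congr 2
    funext k
    rcases k with k | k <;> rfl

theorem HasValue.unique (hy : P.HasValue φ y) (hz : P.HasValue φ z) : y = z := by
  obtain ⟨v, hv, rfl⟩ := hy
  obtain ⟨w, hw, rfl⟩ := hz
  have key : ∀ n, ∀ j, P.level j = n → v j = w j := by
    intro n
    induction n using Nat.strong_induction_on with
    | _ n ih =>
      rintro j rfl
      refine Units.ext ?_
      rw [hv j, hw j]
      congr 3
      funext k
      rw [ih _ k.2 k.1 rfl]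
  congr 3
  funext j
  rw [key _ j rfl]

/-- Over a fully invertible system `𝒮`, the denominators of a presentation may be computed in
`A_𝒮`: being units there places them in the sets `S_i`. -/
theorem presents_iff_hasValue {s : SetSeq A} (hs : s.IsFullyInvertible) {y : s.Localization} :
    P.Presents s y ↔ P.HasValue s.i y := by
  constructor
  · rintro ⟨d, hd, h, rfl⟩
    have hx : ∀ j, s.toLim (P.level j + 1) (s.x (P.level j) (d j) (hd j)) =
        ((s.isUnit_toLim (hd j)).unit⁻¹ : s.Localizationˣ) := fun j => s.toLim_x (hd j) _ rfl
    refine ⟨fun j => (s.isUnit_toLim (hd j)).unit, fun j => ?_, ?_⟩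
    · refine (congrArg (s.toLim _) (h j)).trans ((map_freeAlgebra_lift _ _ _).trans ?_)
      congr 2
      funext k
      rcases k with k | k
      · exact s.toLim_map _ _
      · exact (s.toLim_map _ _).trans (hx k)
    · congr 2
      funext k
      rcases k with k | k
      · rfl
      · exact hx k
  · rintro ⟨v, hv, rfl⟩
    -- By recursion on the level, construct denominators in the rings `A_n` which map to the
    -- given units of `A_𝒮`; `T j` records the invariant that the recursion needs.
    let T (j : P.ι) : Type u := {d : s.ring (P.level j) // d ∈ s.set (P.level j) ∧
      s.toLim (P.level j) d = v j}
    let val (j : P.ι) (rec : ∀ k, P.level k < P.level j → T k) : s.ring (P.level j) :=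
      FreeAlgebra.lift ℤ (Sum.elim
        (fun r => s.map 0 (P.level j) (Nat.zero_le _) (s.base (P.coeff r)))
        (fun k : {k // P.level k < P.level j} => s.map (P.level k + 1) (P.level j) k.2
          (s.x (P.level k) (rec k k.2).1 (rec k k.2).2.1))) (P.denom j)
    have hval : ∀ j rec, s.toLim (P.level j) (val j rec) = v j := by
      intro j rec
      refine (map_freeAlgebra_lift _ _ _).trans (Eq.trans ?_ (hv j).symm)
      congr 2
      funext k
      rcases k with k | k
      · exact s.toLim_map _ _
      · exact (s.toLim_map _ _).trans (s.toLim_x _ _ (rec k k.2).2.2)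
    let F (j : P.ι) (rec : ∀ k, P.level k < P.level j → T k) : T j :=
      ⟨val j rec, hs.mem_set_iff.mpr (by rw [hval]; exact (v j).isUnit), hval j rec⟩
    let wf : WellFounded fun k j => P.level k < P.level j := (measure P.level).wf
    let D : ∀ j, T j := wf.fix F
    have hD : ∀ j, D j = F j fun k _ => D k := fun j => wf.fix_eq F j
    refine ⟨fun j => (D j).1, fun j => (D j).2.1, fun j => congrArg Subtype.val (hD j), ?_⟩
    congr 2
    funext k
    rcases k with k | k
    · rfl
    · exact (s.toLim_x _ _ (D k).2.2).symm

theorem HasValue.union (hP : P.HasValue φ y) (hQ : Q.HasValue φ z) {w : R}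
    (f : FreeAlgebra ℤ ((P.κ ⊕ Q.κ) ⊕ (P.ι ⊕ Q.ι)))
    (hw : ∀ v : (P.κ ⊕ Q.κ) ⊕ (P.ι ⊕ Q.ι) → R,
      y = FreeAlgebra.lift ℤ v (rename (Sum.map Sum.inl Sum.inl) P.poly) →
      z = FreeAlgebra.lift ℤ v (rename (Sum.map Sum.inr Sum.inr) Q.poly) →
      w = FreeAlgebra.lift ℤ v f) :
    (P.union Q f).HasValue φ w := by
  obtain ⟨d, hd, hy⟩ := hP
  obtain ⟨e, he, hz⟩ := hQ
  refine ⟨Sum.elim d e, ?_, ?_⟩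
  · rintro (j | j)
    · refine (hd j).trans (Eq.trans ?_ (lift_rename _ _ _).symm)
      congr 2
      funext v
      rcases v with v | v <;> rfl
    · refine (he j).trans (Eq.trans ?_ (lift_rename _ _ _).symm)
      congr 2
      funext v
      rcases v with v | v <;> rfl
  · apply hw
    · refine hy.trans (Eq.trans ?_ (lift_rename _ _ _).symm)
      congr 2
      funext v
      rcases v with v | v <;> rfl
    · refine hz.trans (Eq.trans ?_ (lift_rename _ _ _).symm)
      congr 2
      funext v
      rcases v with v | v <;> rfl

theorem hasValue_const (a : A) : (const a).HasValue φ (φ a) :=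
  ⟨fun j => j.elim, fun j => j.elim,
    eq_lift_inl (κ := Unit) (ι := Empty) (fun _ => φ a) _ ()⟩

theorem HasValue.neg (hP : P.HasValue φ y) :
    ({ P with poly := -P.poly } : Presentation A).HasValue φ (-y) := by
  obtain ⟨v, hv, rfl⟩ := hP
  exact ⟨v, hv, (map_neg (FreeAlgebra.lift ℤ _) _).symm⟩

/-- The inverse of a value is presented by adjoining the value as one more denominator, at a level
above all others. -/
theorem HasValue.exists_inv (hP : P.HasValue φ y) (hyz : y * z = 1) (hzy : z * y = 1) :
    ∃ Q : Presentation A, Q.HasValue φ z := by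
  let w : Rˣ := ⟨y, z, hyz, hzy⟩
  obtain ⟨v, hv, hw⟩ := hP
  have := P.finite_ι
  obtain ⟨N, hN⟩ := (Set.finite_range P.level).bddAbove
  have hN' : ∀ j, P.level j < N + 1 := fun j => Nat.lt_succ_of_le (hN ⟨j, rfl⟩)
  refine ⟨{ κ := P.κ
            finite_κ := P.finite_κ
            coeff := P.coeff
            ι := Option P.ι
            finite_ι := inferInstance
            level := fun j => j.elim (N + 1) P.level
            denom := fun j => match j with
              | some j => rename (Sum.map id fun k => ⟨some k.1, k.2⟩) (P.denom j)
              | none => rename (Sum.map id fun k => ⟨some k, hN' k⟩) P.poly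
            poly := FreeAlgebra.ι ℤ (Sum.inr none) }, fun j => j.elim w v, ?_, ?_⟩
  · rintro (_ | j)
    · refine hw.trans (Eq.trans ?_ (lift_rename _ _ _).symm)
      congr 2
      funext k
      rcases k with k | k <;> rfl
    · refine (hv j).trans (Eq.trans ?_ (lift_rename _ _ _).symm)
      congr 2
      funext k
      rcases k with k | k <;> rfl
  · exact (FreeAlgebra.lift_ι_apply (R := ℤ) (Sum.elim (fun r => φ (P.coeff r))
      fun j : Option P.ι => ((j.elim w v)⁻¹ : Rˣ)) (Sum.inr none)).symm

/-- The subring of elements of `R` which are values of presentations. -/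
def presentedSubring (φ : A →+* R) : Subring R where
  carrier := {y | ∃ P : Presentation A, P.HasValue φ y}
  zero_mem' := ⟨const 0, by simpa using hasValue_const (φ := φ) 0⟩
  one_mem' := ⟨const 1, by simpa using hasValue_const (φ := φ) 1⟩
  add_mem' := by
    rintro y z ⟨P, hP⟩ ⟨Q, hQ⟩
    exact ⟨_, hP.union hQ (rename (Sum.map Sum.inl Sum.inl) P.poly +
      rename (Sum.map Sum.inr Sum.inr) Q.poly)
      fun v hy hz => (congrArg₂ (· + ·) hy hz).trans (map_add _ _ _).symm⟩
  mul_mem' := by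
    rintro y z ⟨P, hP⟩ ⟨Q, hQ⟩
    exact ⟨_, hP.union hQ (rename (Sum.map Sum.inl Sum.inl) P.poly *
      rename (Sum.map Sum.inr Sum.inr) Q.poly)
      fun v hy hz => (congrArg₂ (· * ·) hy hz).trans (map_mul _ _ _).symm⟩
  neg_mem' := by
    rintro y ⟨P, hP⟩
    exact ⟨_, hP.neg⟩

end Presentation

theorem Fraction.exists_hasValue {A : Type u} [Ring A] {n : ℕ} (a : Fraction A n) (b : a.ring) :
    ∃ P : Presentation A, P.HasValue a.of b := by
  induction n with
  | zero => exact ⟨Presentation.const b, Presentation.hasValue_const (φ := a.of) b⟩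
  | succ n ih =>
    let T : Subring a.ring := Presentation.presentedSubring a.of
    refine Loc.mem_of_subring (S := {a.last}) T (fun c => ?_) (fun t => ?_) b
    · obtain ⟨P, hP⟩ := ih a.init c
      exact ⟨P, hP.map (a.init.ofSnoc a.last)⟩
    · obtain ⟨P, hP⟩ := ih a.init t.1
      have h := hP.map (a.init.ofSnoc a.last)
      exact h.exists_inv (z := Loc.x {a.last} t) (Loc.of_mul_x {a.last} t) (Loc.x_mul_of {a.last} t)

/-! ### The topology of the full spectrum -/

variable {A : Type u} [Ring A]

theorem Fraction.D_subset_of_hom {m n : ℕ} {a : Fraction A m} {b : Fraction A n}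
    (f : a.ring →+* b.ring) (hf : f.comp a.of = b.of) : b.D ⊆ a.D :=
  fun S hS => Fraction.mem_of_hom S.isFullyInvertible f hf hS

/-- The fundamental sets form a basis of the topology, not only a subbasis. -/
theorem exists_D_subset {U : Set (FullSpectrum A)} (hU : IsOpen U) {S : FullSpectrum A}
    (hS : S ∈ U) : ∃ (n : ℕ) (a : Fraction A n), a.Mem S.sys ∧ a.D ⊆ U := by
  induction hU with
  | basic U hU =>
    obtain ⟨n, a, rfl⟩ := hU
    exact ⟨n, a, hS, subset_rfl⟩
  | univ => exact ⟨0, PUnit.unit, trivial, Set.subset_univ _⟩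
  | inter U V _ _ ihU ihV =>
    obtain ⟨m, a, ha, haU⟩ := ihU hS.1
    obtain ⟨n, b, hb, hbV⟩ := ihV hS.2
    obtain ⟨k, c, hc, ⟨f, hf⟩, g, hg⟩ :=
      Fraction.exists_common_refinement S.isFullyInvertible a b ha hb
    exact ⟨k, c, hc, Set.subset_inter ((Fraction.D_subset_of_hom f hf).trans haU)
      ((Fraction.D_subset_of_hom g hg).trans hbV)⟩
  | sUnion W _ ih =>
    obtain ⟨V, hV, hSV⟩ := hS
    obtain ⟨n, a, ha, haV⟩ := ih V hV hSV
    exact ⟨n, a, ha, haV.trans (Set.subset_sUnion_of_mem hV)⟩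

namespace Fraction

variable {n : ℕ} (a : Fraction A n)

theorem nontrivial_ring (h : a.D.Nonempty) : Nontrivial a.ring := by
  obtain ⟨S, hS⟩ := h
  have := S.isFullyInvertible.nontrivial
  exact (a.toLocalization S.sys hS).domain_nontrivial

/-- The system determined by `A → A_𝐚`, the most special point of `D(𝐚)`. -/
def center (h : a.D.Nonempty) : FullSpectrum A :=
  ⟨SetSeq.ofHom a.of, a.ring, _, a.nontrivial_ring h, a.of, rfl⟩

theorem mem_center (h : a.D.Nonempty) : a.Mem (a.center h).sys :=
  have := a.nontrivial_ring h
  a.mem_ofHom a.of (RingHom.id _) rfl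

/-- The homomorphism `A_𝒮 → A_𝐚` for the center `𝒮` of `D(𝐚)`. -/
def centerHom (h : a.D.Nonempty) : (a.center h).sys.Localization →+* a.ring :=
  SetSeq.toTarget a.of

theorem centerHom_comp_i (h : a.D.Nonempty) : (a.centerHom h).comp (a.center h).sys.i = a.of :=
  SetSeq.toTarget_comp_i a.of

/-- `D(𝐚)` is the smallest neighbourhood of its center: if `𝐛` belongs to the center, then
`A_𝐛` maps to `A_𝐚` over `A`, and hence to `A_𝒮` for every `𝒮 ∈ D(𝐚)`. -/
theorem D_subset_of_center_mem (h : a.D.Nonempty) {U : Set (FullSpectrum A)} (hU : IsOpen U)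
    (hc : a.center h ∈ U) : a.D ⊆ U := by
  obtain ⟨m, b, hb, hbU⟩ := exists_D_subset hU hc
  refine (D_subset_of_hom ((a.centerHom h).comp (b.toLocalization _ hb)) ?_).trans hbU
  rw [RingHom.comp_assoc, toLocalization_comp_of, centerHom_comp_i]

/-! ### Sections over the fundamental sets -/

/-- The section over `D(𝐚)` given by `b ∈ A_𝐚`. -/
def toSections : a.ring →+* (structureSheaf A).presheaf.obj (op a.opens) where
  toFun b := show sections A a.opens from ⟨fun S => a.toLocalization S.1.sys S.2 b, fun S =>
    ⟨a.opens, S.2, 𝟙 _, (a.exists_hasValue b).choose, fun T =>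
      (Presentation.presents_iff_hasValue T.1.isFullyInvertible).mpr
        (a.toLocalization_comp_of T.2 ▸
          (a.exists_hasValue b).choose_spec.map (a.toLocalization T.1.sys T.2))⟩⟩
  map_one' := Subtype.ext (funext fun _ => map_one _)
  map_mul' _ _ := Subtype.ext (funext fun _ => map_mul _ _ _)
  map_zero' := Subtype.ext (funext fun _ => map_zero _)
  map_add' _ _ := Subtype.ext (funext fun _ => map_add _ _ _)

theorem toSections_injective (h : a.D.Nonempty) : Function.Injective a.toSections := by
  intro b c hbc
  have h1 : a.toLocalization _ (a.mem_center h) b = a.toLocalization _ (a.mem_center h) c :=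
    congrArg (fun t => value t (a.center h) (a.mem_center h)) hbc
  have h2 : (a.centerHom h).comp (a.toLocalization _ (a.mem_center h)) = RingHom.id a.ring :=
    a.hom_ext (by
      rw [RingHom.comp_assoc, toLocalization_comp_of, centerHom_comp_i, RingHom.id_comp])
  exact (DFunLike.congr_fun h2 b).symm.trans
    ((congrArg (a.centerHom h) h1).trans (DFunLike.congr_fun h2 c))

/-- A presentation of a section near the center of `D(𝐚)` is valid on all of `D(𝐚)`. Its value
at the center, carried to `A_𝐚`, induces its values at all points of `D(𝐚)`. -/
theorem toSections_surjective (h : a.D.Nonempty) : Function.Surjective a.toSections := by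
  intro t
  obtain ⟨V, hV, i, P, hP⟩ := (show sections A a.opens from t).2 ⟨a.center h, a.mem_center h⟩
  have hDV : a.D ⊆ V := a.D_subset_of_center_mem h V.2 hV
  have hv : ∀ S (hS : S ∈ a.opens), P.HasValue S.sys.i (value t S hS) := fun S hS =>
    (Presentation.presents_iff_hasValue S.isFullyInvertible).mp (hP ⟨S, hDV hS⟩)
  have h1 := (hv _ (a.mem_center h)).map (a.centerHom h)
  rw [centerHom_comp_i] at h1
  refine ⟨a.centerHom h (value t _ (a.mem_center h)), Subtype.ext (funext fun S => ?_)⟩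
  have hS : a.Mem S.1.sys := S.2
  have h2 := h1.map (a.toLocalization S.1.sys hS)
  rw [toLocalization_comp_of] at h2
  exact h2.unique (hv S.1 S.2)

/-- `A_𝐚 ≅ 𝒪_A(D(𝐚))` for nonempty `D(𝐚)`. -/
def sectionsEquiv (h : a.D.Nonempty) :
    a.ring ≃+* (structureSheaf A).presheaf.obj (op a.opens) :=
  RingEquiv.ofBijective a.toSections ⟨a.toSections_injective h, a.toSections_surjective h⟩

theorem toLocalization_sectionsEquiv_symm (h : a.D.Nonempty)
    (t : (structureSheaf A).presheaf.obj (op a.opens)) (S : FullSpectrum A) (hS : a.Mem S.sys) :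
    a.toLocalization S.sys hS ((a.sectionsEquiv h).symm t) = value t S hS := by
  obtain ⟨b, rfl⟩ := (a.sectionsEquiv h).surjective t
  rw [RingEquiv.symm_apply_apply]
  rfl

end Fraction

/-! ### Stalks -/

/-- Evaluation of sections at `𝒮`. -/
def valueHom (S : FullSpectrum A) {U : Opens (TopCat.of (FullSpectrum A))} (hS : S ∈ U) :
    (structureSheaf A).presheaf.obj (op U) →+* S.sys.Localization where
  toFun t := value t S hS
  map_one' := rfl
  map_mul' _ _ := rfl
  map_zero' := rfl
  map_add' _ _ := rfl

/-- Evaluation of germs at `𝒮`. -/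
def stalkValue (S : FullSpectrum A) :
    (structureSheaf A).presheaf.stalk S ⟶ RingCat.of S.sys.Localization :=
  Limits.colimit.desc _
    { pt := RingCat.of S.sys.Localization
      ι := { app := fun U => RingCat.ofHom (valueHom S U.unop.2)
             naturality := fun _ _ _ => rfl } }

theorem stalkValue_germ (S : FullSpectrum A) (U : Opens (TopCat.of (FullSpectrum A)))
    (hS : S ∈ U) (t : (structureSheaf A).presheaf.obj (op U)) :
    (stalkValue S).hom ((structureSheaf A).presheaf.germ U S hS t) = value t S hS := by
  have : (structureSheaf A).presheaf.germ U S hS ≫ stalkValue S =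
      RingCat.ofHom (valueHom S hS) := Limits.colimit.ι_desc _ _
  exact DFunLike.congr_fun (congrArg RingCat.Hom.hom this) t

/-- The canonical homomorphism from `A_𝐚` to the stalk at `𝒮 ∈ D(𝐚)`. -/
def Fraction.toStalk {n : ℕ} (a : Fraction A n) (S : FullSpectrum A) (hS : S ∈ a.opens) :
    a.ring →+* (structureSheaf A).presheaf.stalk S :=
  ((structureSheaf A).presheaf.germ a.opens S hS).hom.comp a.toSections

/-- The empty fraction. -/
def Fraction.empty : Fraction A 0 := PUnit.unit

/-- The canonical homomorphism from `A` to the stalk at `𝒮`. -/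
def baseToStalk (S : FullSpectrum A) : A →+* (structureSheaf A).presheaf.stalk S :=
  (Fraction.empty (A := A)).toStalk S trivial

theorem Fraction.toStalk_comp_of {n : ℕ} (a : Fraction A n) (S : FullSpectrum A)
    (hS : S ∈ a.opens) : (a.toStalk S hS).comp a.of = baseToStalk S := by
  ext r
  have hle : a.opens ≤ (Fraction.empty (A := A)).opens := fun _ _ => trivial
  have hres : (structureSheaf A).presheaf.map (homOfLE hle).op (Fraction.empty.toSections r) =
      a.toSections (a.of r) :=
    Subtype.ext (funext fun T =>
      (DFunLike.congr_fun (a.toLocalization_comp_of (s := T.1.sys) T.2) r).symm)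
  have hg := TopCat.Presheaf.germ_res_apply (structureSheaf A).presheaf (homOfLE hle) S hS
    (Fraction.empty.toSections r)
  rw [hres] at hg
  exact hg

theorem stalkValue_toStalk {n : ℕ} (a : Fraction A n) (S : FullSpectrum A)
    (hS : S ∈ a.opens) (b : a.ring) :
    (stalkValue S).hom (a.toStalk S hS b) = a.toLocalization S.sys hS b :=
  stalkValue_germ S _ hS _

theorem stalkValue_comp_base (S : FullSpectrum A) :
    (stalkValue S).hom.comp (baseToStalk S) = S.sys.i :=
  RingHom.ext fun r => stalkValue_toStalk Fraction.empty S trivial r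

/-- Every germ at `𝒮` comes from some `A_𝐚` with `𝐚 ∈ 𝒮`. -/
theorem exists_toStalk (S : FullSpectrum A) (z : (structureSheaf A).presheaf.stalk S) :
    ∃ (n : ℕ) (a : Fraction A n) (hS : S ∈ a.opens) (b : a.ring), a.toStalk S hS b = z := by
  obtain ⟨U, hU, t, rfl⟩ := TopCat.Presheaf.exists_germ_eq (structureSheaf A).presheaf z
  obtain ⟨n, a, ha, haU⟩ := exists_D_subset U.2 hU
  have hle : a.opens ≤ U := haU
  obtain ⟨b, hb⟩ := a.toSections_surjective ⟨S, ha⟩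
    ((structureSheaf A).presheaf.map (homOfLE hle).op t)
  refine ⟨n, a, ha, b, ?_⟩
  have hg := TopCat.Presheaf.germ_res_apply (structureSheaf A).presheaf (homOfLE hle) S ha t
  rw [← hb] at hg
  exact hg

/-- `A → 𝒪_{A,𝒮}` is an epimorphism. -/
theorem stalk_hom_ext (S : FullSpectrum A) {R : Type*} [Ring R]
    {f g : (structureSheaf A).presheaf.stalk S →+* R}
    (h : f.comp (baseToStalk S) = g.comp (baseToStalk S)) : f = g := by
  ext z
  obtain ⟨n, a, hS, b, rfl⟩ := exists_toStalk S z
  have : f.comp (a.toStalk S hS) = g.comp (a.toStalk S hS) := a.hom_ext (by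
    rw [RingHom.comp_assoc, RingHom.comp_assoc, a.toStalk_comp_of, h])
  exact DFunLike.congr_fun this b

/-- Evaluation of germs reflects units: if the value of `b ∈ A_𝐚` at `𝒮` is a unit, then
`(𝐚, b) ∈ 𝒮`, and `b` is invertible on `D((𝐚, b))`. -/
theorem isUnit_of_isUnit_stalkValue (S : FullSpectrum A)
    (z : (structureSheaf A).presheaf.stalk S) (hz : IsUnit ((stalkValue S).hom z)) :
    IsUnit z := by
  obtain ⟨n, a, hS, b, rfl⟩ := exists_toStalk S z
  rw [stalkValue_toStalk] at hz
  have hb : S ∈ (a.snoc b).opens := a.mem_snoc S.isFullyInvertible hS b hz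
  have : ((a.snoc b).toStalk S hb).comp (a.ofSnoc b) = a.toStalk S hS := a.hom_ext (by
    rw [RingHom.comp_assoc, a.ofSnoc_comp_of, Fraction.toStalk_comp_of, Fraction.toStalk_comp_of])
  rw [← this]
  exact (a.isUnit_ofSnoc b).map ((a.snoc b).toStalk S hb)

theorem stalkValue_bijective (S : FullSpectrum A) : Function.Bijective (stalkValue S).hom := by
  obtain ⟨g, hg⟩ := S.sys.exists_hom_of_isLocalHom (baseToStalk S) (stalkValue S).hom
    (stalkValue_comp_base S) (isUnit_of_isUnit_stalkValue S)
  have h1 : g.comp (stalkValue S).hom = RingHom.id _ := stalk_hom_ext S (by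
    rw [RingHom.comp_assoc, stalkValue_comp_base, hg, RingHom.id_comp])
  have h2 : (stalkValue S).hom.comp g = RingHom.id _ := S.sys.hom_ext (by
    rw [RingHom.comp_assoc, hg, stalkValue_comp_base, RingHom.id_comp])
  exact Function.bijective_iff_has_inverse.mpr
    ⟨g, DFunLike.congr_fun h1, DFunLike.congr_fun h2⟩

theorem opens_empty : (Fraction.empty (A := A)).opens = ⊤ :=
  TopologicalSpace.Opens.ext (Set.eq_univ_of_forall fun _ => trivial)

end FSpec

end

theorem mainTheorem2 {A : Type u} [Ring A] [Nontrivial A] :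
    (∀ S : FSpec.FullSpectrum A,
      ∃ e : (FSpec.structureSheaf A).presheaf.stalk S ≃+* S.sys.Localization,
        ∀ (U : Opens (TopCat.of (FSpec.FullSpectrum A))) (hS : S ∈ U)
          (t : (FSpec.structureSheaf A).presheaf.obj (op U)),
          e ((FSpec.structureSheaf A).presheaf.germ U S hS t) = FSpec.value t S hS) ∧
    (∀ (n : ℕ) (a : FSpec.Fraction A n), a.D.Nonempty →
      ∃ e : (FSpec.structureSheaf A).presheaf.obj (op a.opens) ≃+* a.ring,
        ∀ (t : (FSpec.structureSheaf A).presheaf.obj (op a.opens))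
          (S : FSpec.FullSpectrum A) (hS : a.Mem S.sys),
          a.toLocalization S.sys hS (e t) = FSpec.value t S hS) ∧
    (∃ e : (FSpec.structureSheaf A).presheaf.obj (op ⊤) ≃+* A,
      ∀ (t : (FSpec.structureSheaf A).presheaf.obj (op ⊤)) (S : FSpec.FullSpectrum A),
        S.sys.i (e t) = FSpec.value t S (Opens.mem_top S)) := by
  refine ⟨fun S => ⟨RingEquiv.ofBijective _ (FSpec.stalkValue_bijective S),
    fun U hS t => FSpec.stalkValue_germ S U hS t⟩,
    fun n a h => ⟨(a.sectionsEquiv h).symm, a.toLocalization_sectionsEquiv_symm h⟩, ?_⟩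
  have h : (FSpec.Fraction.empty (A := A)).D.Nonempty :=
    ⟨⟨FSpec.SetSeq.ofHom (RingHom.id A), A, _, ‹_›, _, rfl⟩, trivial⟩
  have key : ∀ (U : Opens (TopCat.of (FSpec.FullSpectrum A)))
      (hU : (FSpec.Fraction.empty (A := A)).opens = U),
      ∃ e : (FSpec.structureSheaf A).presheaf.obj (op U) ≃+* A,
        ∀ (t : (FSpec.structureSheaf A).presheaf.obj (op U)) (S : FSpec.FullSpectrum A)
          (hS : S ∈ U), S.sys.i (e t) = FSpec.value t S hS := by
    rintro _ rfl
    exact ⟨(FSpec.Fraction.empty.sectionsEquiv h).symm,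
      FSpec.Fraction.empty.toLocalization_sectionsEquiv_symm h⟩
  obtain ⟨e, he⟩ := key ⊤ FSpec.opens_empty
  exact ⟨e, fun t S => he t S _⟩
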